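/- Let $\nu,n,m,r\ge 0$ be integers and let $A_\ell\in\mathbb R^{n\times n}$, $B_\ell\in\mathbb R^{n\times m}$, $C_\ell\in\mathbb R^{r\times n}$, $D_\ell\in\mathbb R^{r\times m}$, $G_\ell\in\mathbb R^{m\times r}$, $V_\ell\in\mathbb R^{n\times n}$ ($\ell\in\mathbb Z^\nu$) be square summable families of matrices, with $V_{-\ell}=V_\ell^{\mathrm T}$, such that the block Toeplitz matrices $A=(A_{j-k})_{j,k\in\mathbb Z^\nu}$, $B$, $C$, $D$, $G$, $V$ (defined likewise) specify bounded operators between the real Hilbert spaces $\mathfrak X=\ell^2(\mathbb Z^\nu,\mathbb R^n)$ (states), $\mathfrak U=\ell^2(\mathbb Z^\nu,\mathbb R^m)$ (inputs) and $\mathfrak Y=\ell^2(\mathbb Z^\nu,\mathbb R^r)$ (outputs). For $M$ any of these let $\mathcal M(\sigma)=\sum_{\ell\in\mathbb Z^\nu}e^{-i\ell^{\mathrm T}\sigma}M_\ell$ be the corresponding Fourier series, convergent in $L^2$ of the torus $\mathbb T^\nu=(\mathbb R/2\pi\mathbb Z)^\nu$ and so defined for almost every $\sigma$; this gives $\mathcal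 A,\mathcal B,\mathcal C,\mathcal D,\mathcal G,\mathcal V$. Put $$N(\sigma)=\begin{bmatrix}-\mathcal A(\sigma)^*\mathcal V(\sigma)-\mathcal V(\sigma)\mathcal A(\sigma) & \mathcal C(\sigma)^*\mathcal G(\sigma)^*-\mathcal V(\sigma)\mathcal B(\sigma)\\ \mathcal G(\sigma)\mathcal C(\sigma)-\mathcal B(\sigma)^*\mathcal V(\sigma) & \mathcal G(\sigma)\mathcal D(\sigma)+\mathcal D(\sigma)^*\mathcal G(\sigma)^*\end{bmatrix}.$$ For an initial state $x_0\in\mathfrak X$ and a locally integrable input $u:[0,\infty)\to\mathfrak U$ (that is, $\int_0^T\|u(t)\|_2\,dt<\infty$ for all $T>0$), let $x$ be the continuous solution of $x(t)=x_0+\int_0^t(Ax(\tau)+Bu(\tau))\,d\tau$, $t\ge 0$, and put $y=Cx+Du$, $S(t)=\langle u(t),Gy(t)\rangle$ (supply rate) and $H(t)=\tfrac12\langle x(t),Vx(t)\rangle$ (energy). Then: (a) for all such $x_0$ and $u$, $H$ is differentiable at almost every $t>0$, so that the energy dissipation rate $S(t)-\dot H(t)$ is defined for almost every $t>0$; (b)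 if $N(\sigma)$ is positive semidefinite for almost every $\sigma\in\mathbb T^\nu$, then for all such $x_0$ and $u$ one has $S(t)-\dot H(t)\ge 0$ for almost every $t>0$; (c) if the pair $(\mathcal A(\sigma),\mathcal B(\sigma))$ is controllable for almost every $\sigma\in\mathbb T^\nu$ (that is, $[\mathcal B,\mathcal A\mathcal B,\dots,\mathcal A^{n-1}\mathcal B](\sigma)$ has rank $n$), then $S(t)-\dot H(t)\ge 0$ holds for almost every $t>0$ for all such $x_0$ and $u$ if and only if $N(\sigma)$ is positive semidefinite for almost every $\sigma\in\mathbb T^\nu$. -/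

import Mathlib

open MeasureTheory
open scoped ComplexOrder Matrix

noncomputable section

namespace LatticeNet

/-- The integer lattice `ℤ^ν`. -/
abbrev Lattice (ν : ℕ) : Type := Fin ν → ℤ

/-- The real Hilbert space of square summable functions on the lattice with values in `ℝ^p`;
its inner product is `⟪f, g⟫ = ∑ₖ fₖᵀ gₖ`. -/
abbrev Sig (ν p : ℕ) : Type := lp (fun _ : Lattice ν => EuclideanSpace ℝ (Fin p)) 2

/-- A real `p × q` matrix attached to every (relative) lattice location. -/
abbrev MatSeq (ν p q : ℕ) : Type := Lattice ν → Matrix (Fin p) (Fin q) ℝ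

/-- Square summability `∑_ℓ ‖M_ℓ‖² < ∞` (with the Frobenius norm). -/
def SquareSummable {ν p q : ℕ} (M : MatSeq ν p q) : Prop :=
  Summable fun ℓ => ∑ i, ∑ j, (M ℓ i j) ^ 2

/-- `L` is the operator of the block Toeplitz matrix `(M_{j-k})_{j,k}`. -/
def IsToeplitz {ν p q : ℕ} (M : MatSeq ν p q) (L : Sig ν q →L[ℝ] Sig ν p) : Prop :=
  ∀ (f : Sig ν q) (j : Lattice ν),
    HasSum (fun k => Matrix.toEuclideanLin (M (j - k)) (f k)) (L f j)

/-- The block Toeplitz matrix `(M_{j-k})_{j,k}` specifies a bounded operator on square summable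
functions. -/
def IsBoundedToeplitz {ν p q : ℕ} (M : MatSeq ν p q) : Prop :=
  ∃ L : Sig ν q →L[ℝ] Sig ν p, IsToeplitz M L

open Classical in
/-- The bounded operator specified by the block Toeplitz matrix `(M_{j-k})_{j,k}`
(it is unique when it exists; `0` if the matrix does not specify a bounded operator). -/
def toeplitz {ν p q : ℕ} (M : MatSeq ν p q) : Sig ν q →L[ℝ] Sig ν p :=
  if h : IsBoundedToeplitz M then h.choose else 0

theorem toeplitz_spec {ν p q : ℕ} {M : MatSeq ν p q} (h : IsBoundedToeplitz M) :
    IsToeplitz M (toeplitz M) := by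
  unfold toeplitz
  rw [dif_pos h]
  exact h.choose_spec

/-- The normalized Haar (Lebesgue) measure on the torus. -/
abbrev torusMeasure (ν : ℕ) : Measure (UnitAddTorus (Fin ν)) :=
  Measure.pi fun _ => AddCircle.haarAddCircle

/-- The Fourier series `∑_ℓ e^{-i ℓᵀ σ} M_ℓ`, entrywise as a sum in `L²` of the torus.
The torus is parametrized by `θ ∈ (ℝ/ℤ)^ν`, with `σ = 2πθ`, so that
`mFourier (-ℓ) θ = e^{-2πi ℓᵀθ} = e^{-i ℓᵀσ}`. The values are meaningful for almost every `θ`. -/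
def symbol {ν p q : ℕ} (M : MatSeq ν p q) (θ : UnitAddTorus (Fin ν)) :
    Matrix (Fin p) (Fin q) ℂ :=
  Matrix.of fun i j =>
    (∑' ℓ : Lattice ν, ((M ℓ i j : ℝ) : ℂ) • UnitAddTorus.mFourierLp 2 (-ℓ) :
      Lp ℂ 2 (torusMeasure ν)) θ

/-- Controllability of a matrix pair: `[B, AB, …, A^{n-1}B]` has full row rank. -/
def Controllable {n m : ℕ} (A : Matrix (Fin n) (Fin n) ℂ) (B : Matrix (Fin n) (Fin m) ℂ) : Prop :=
  (Matrix.of fun (i : Fin n) (q : Fin n × Fin m) => (A ^ (q.1 : ℕ) * B) i q.2).rank = n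

/-- The data of a translation invariant network: state-space matrices `A, B, C, D`, the matrices
`G` of the supply rate and `V` of the energy. -/
structure Network (ν n m r : ℕ) where
  A : MatSeq ν n n
  B : MatSeq ν n m
  C : MatSeq ν r n
  D : MatSeq ν r m
  G : MatSeq ν m r
  V : MatSeq ν n n

variable {ν n m r : ℕ}

/-- Local integrability in time of an input on `[0, ∞)`: `∫₀ᵀ ‖u(t)‖₂ dt < ∞` for all `T > 0`. -/
def Admissible (u : ℝ → Sig ν m) : Prop :=
  ∀ T : ℝ, 0 < T → IntegrableOn u (Set.Ioc 0 T)

namespace Network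

/-- `x` is the network state produced by the initial state `x₀` and the input `u`: a continuous
solution on `[0, ∞)` of `ẋ = A x + B u`, understood as a Volterra integral equation. -/
structure IsState (P : Network ν n m r) (x₀ : Sig ν n) (u : ℝ → Sig ν m) (x : ℝ → Sig ν n) :
    Prop where
  continuousOn : ContinuousOn x (Set.Ici 0)
  eq_integral : ∀ t : ℝ, 0 ≤ t →
    x t = x₀ + ∫ τ in (0 : ℝ)..t, (toeplitz P.A (x τ) + toeplitz P.B (u τ))

/-- The output `y = C x + D u`. -/
def output (P : Network ν n m r) (u : ℝ → Sig ν m) (x : ℝ → Sig ν n) (t : ℝ) : Sig ν r :=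
  toeplitz P.C (x t) + toeplitz P.D (u t)

/-- The supply rate `S(t) = ⟪u(t), G y(t)⟫`. -/
def supply (P : Network ν n m r) (u : ℝ → Sig ν m) (x : ℝ → Sig ν n) (t : ℝ) : ℝ :=
  inner ℝ (u t) (toeplitz P.G (P.output u x t))

/-- The energy `H(t) = ½ ⟪x(t), V x(t)⟫`. -/
def energy (P : Network ν n m r) (x : ℝ → Sig ν n) (t : ℝ) : ℝ :=
  (1 / 2) * inner ℝ (x t) (toeplitz P.V (x t))

/-- The energy dissipation rate `S(t) - Ḣ(t)`. -/
def dissipationRate (P : Network ν n m r) (u : ℝ → Sig ν m) (x : ℝ → Sig ν n) (t : ℝ) : ℝ :=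
  P.supply u x t - deriv (P.energy x) t

/-- The dissipation rate is nonnegative (at almost every time) for all square summable initial
states and all locally integrable inputs. -/
def Dissipative (P : Network ν n m r) : Prop :=
  ∀ (x₀ : Sig ν n) (u : ℝ → Sig ν m) (x : ℝ → Sig ν n), Admissible u → P.IsState x₀ u x →
    ∀ᵐ t ∂(volume.restrict (Set.Ioi (0 : ℝ))), 0 ≤ P.dissipationRate u x t

/-- The matrix `N(σ)`, `σ = 2πθ`. -/
def N (P : Network ν n m r) (θ : UnitAddTorus (Fin ν)) :
    Matrix (Fin n ⊕ Fin m) (Fin n ⊕ Fin m) ℂ :=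
  Matrix.fromBlocks
    (-((symbol P.A θ)ᴴ * symbol P.V θ) - symbol P.V θ * symbol P.A θ)
    ((symbol P.C θ)ᴴ * (symbol P.G θ)ᴴ - symbol P.V θ * symbol P.B θ)
    (symbol P.G θ * symbol P.C θ - (symbol P.B θ)ᴴ * symbol P.V θ)
    (symbol P.G θ * symbol P.D θ + (symbol P.D θ)ᴴ * (symbol P.G θ)ᴴ)

end Network

end LatticeNet

end

/-!
Where the state is differentiable, the dissipation rate is a continuous quadratic form in the
current state and input. Any pair `(x₀, u₀)` is the value at `t = 0` of the trajectory started at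
`x₀` under the constant input `u₀`, along which the rate is continuous; dissipativity is therefore
nonnegativity of this form. The Fourier transform turns the block Toeplitz operators into
multiplication by their symbols, so by Parseval's identity the form is `∫ Re (ŵ* K ŵ)` with
`ŵ = (x̂, û)` and `N = K + K*`. Testing on `ŵ = 1_s c`, for measurable `s` and `c` in a countable
dense set, gives positivity of `N` almost everywhere.

The Fourier transform is applied to complex signals, since the transforms of real ones satisfy
`ŵ(-σ) = conj ŵ(σ)` and cannot be localized on an arbitrary set `s`; the form of a complex signal
is the sum of its values at the real and imaginary parts.
-/

noncomputable section

namespace LatticeNet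

open Filter Topology UnitAddTorus
open scoped ComplexConjugate BoundedContinuousFunction NNReal

section FourierUniqueness

theorem ae_eq_zero_of_forall_integral_nnreal_smul_eq_zero {X E : Type*} [TopologicalSpace X]
    [HasOuterApproxClosed X] [MeasurableSpace X] [BorelSpace X] [NormedAddCommGroup E]
    [NormedSpace ℝ E] [CompleteSpace E] {μ : Measure X} {h : X → E} (hh : Integrable h μ)
    (h0 : ∀ φ : X →ᵇ ℝ≥0, ∫ x, φ x • h x ∂μ = 0) : h =ᵐ[μ] 0 := by
  refine ae_eq_zero_of_forall_setIntegral_isClosed_eq_zero hh fun s hs => ?_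
  have hlim : Tendsto (fun k => ∫ x, hs.apprSeq k x • h x ∂μ) atTop
      (𝓝 (∫ x, s.indicator h x ∂μ)) := by
    refine tendsto_integral_of_dominated_convergence (fun x => ‖h x‖)
      (fun k => (hs.apprSeq k).continuous.aestronglyMeasurable.smul hh.aestronglyMeasurable)
      hh.norm (fun k => Eventually.of_forall fun x => ?_) (Eventually.of_forall fun x => ?_)
    · rw [NNReal.smul_def, norm_smul, NNReal.norm_eq]
      exact mul_le_of_le_one_left (norm_nonneg _)
        (HasOuterApproxClosed.apprSeq_apply_le_one hs k x)
    · have := (tendsto_pi_nhds.1 (HasOuterApproxClosed.tendsto_apprSeq hs) x).smul_const (h x)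
      by_cases hx : x ∈ s <;> simpa [hx] using this
  simp only [h0, integral_indicator hs.measurableSet] at hlim
  exact tendsto_nhds_unique hlim tendsto_const_nhds

variable {ν : ℕ} {E : Type*} [NormedAddCommGroup E] [NormedSpace ℂ E]
  {g h : UnitAddTorus (Fin ν) → E}

theorem integrable_mFourier_smul (hh : Integrable h (torusMeasure ν)) (ℓ : Lattice ν) :
    Integrable (fun θ => mFourier ℓ θ • h θ) (torusMeasure ν) :=
  hh.bdd_smul _ (mFourier ℓ).continuous.aestronglyMeasurable
    (Eventually.of_forall (mFourier ℓ).norm_coe_le_norm)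

theorem mFourierCoeff_eq_integral_torusMeasure (h : UnitAddTorus (Fin ν) → E) (ℓ : Lattice ν) :
    mFourierCoeff h ℓ = ∫ θ, mFourier (-ℓ) θ • h θ ∂(torusMeasure ν) := rfl

theorem mFourierCoeff_congr_ae (hgh : g =ᵐ[torusMeasure ν] h) :
    mFourierCoeff g = mFourierCoeff h :=
  funext fun _ => integral_congr_ae (hgh.mono fun _ hθ => congrArg _ hθ)

variable [CompleteSpace E]

theorem integral_smul_eq_zero_of_mFourierCoeff_eq_zero (hh : Integrable h (torusMeasure ν))
    (h0 : ∀ ℓ, mFourierCoeff h ℓ = 0) (φ : C(UnitAddTorus (Fin ν), ℂ)) :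
    ∫ θ, φ θ • h θ ∂(torusMeasure ν) = 0 := by
  let L : C(UnitAddTorus (Fin ν), ℂ) →L[ℂ] E :=
    ((ContinuousLinearMap.lsmul ℂ ℂ).lpPairing (torusMeasure ν) ⊤ 1).flip hh.toL1 ∘L
      ContinuousMap.toLp ⊤ (torusMeasure ν) ℂ
  have hL (ψ : C(UnitAddTorus (Fin ν), ℂ)) : L ψ = ∫ θ, ψ θ • h θ ∂(torusMeasure ν) := by
    refine (ContinuousLinearMap.lpPairing_eq_integral _ _ _).trans (integral_congr_ae ?_)
    filter_upwards [ψ.coeFn_toLp (p := ⊤) (𝕜 := ℂ) (torusMeasure ν), hh.coeFn_toL1] with θ hψ hθ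
    exact congrArg₂ (· • ·) hψ hθ
  have hL0 : L = 0 := by
    refine ContinuousLinearMap.ext_on
      (Submodule.dense_iff_topologicalClosure_eq_top.2 span_mFourier_closure_eq_top) ?_
    rintro _ ⟨ℓ, rfl⟩
    rw [hL, zero_apply, ← neg_neg ℓ, ← mFourierCoeff_eq_integral_torusMeasure, h0]
  rw [← hL, hL0, zero_apply]

theorem ae_eq_zero_of_mFourierCoeff_eq_zero (hh : Integrable h (torusMeasure ν))
    (h0 : ∀ ℓ, mFourierCoeff h ℓ = 0) : h =ᵐ[torusMeasure ν] 0 := by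
  refine ae_eq_zero_of_forall_integral_nnreal_smul_eq_zero hh fun φ => ?_
  let ψ : C(UnitAddTorus (Fin ν), ℂ) := ⟨fun θ => ((φ θ : ℝ) : ℂ), by fun_prop⟩
  exact integral_smul_eq_zero_of_mFourierCoeff_eq_zero hh h0 ψ

theorem ae_eq_of_mFourierCoeff_eq (hg : Integrable g (torusMeasure ν))
    (hh : Integrable h (torusMeasure ν)) (H : ∀ ℓ, mFourierCoeff g ℓ = mFourierCoeff h ℓ) :
    g =ᵐ[torusMeasure ν] h := by
  refine (sub_ae_eq_zero _ _).1 (ae_eq_zero_of_mFourierCoeff_eq_zero (hg.sub hh) fun ℓ => ?_)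
  simp only [mFourierCoeff_eq_integral_torusMeasure, Pi.sub_apply, smul_sub]
  rw [integral_sub (integrable_mFourier_smul hg (-ℓ)) (integrable_mFourier_smul hh (-ℓ))]
  exact sub_eq_zero.2 (H ℓ)

end FourierUniqueness

section FourierCoefficients

variable {ν : ℕ}

theorem integrable_coeFn_L2 (f : Lp ℂ 2 (torusMeasure ν)) : Integrable f (torusMeasure ν) :=
  (Lp.memLp f).integrable one_le_two

theorem integrable_mul_coeFn_L2 (f g : Lp ℂ 2 (torusMeasure ν)) :
    Integrable (fun θ => f θ * g θ) (torusMeasure ν) :=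
  (Lp.memLp f).integrable_mul (Lp.memLp g)

theorem mFourierCoeff_mFourier_mul_conj (f : UnitAddTorus (Fin ν) → ℂ) (k ℓ : Lattice ν) :
    mFourierCoeff (fun θ => mFourier k θ * conj (f θ)) ℓ = conj (mFourierCoeff f (k - ℓ)) := by
  rw [mFourierCoeff, mFourierCoeff, ← integral_conj]
  congr 1 with θ
  rw [smul_eq_mul, smul_eq_mul, map_mul, ← mFourier_neg, ← mul_assoc, ← mFourier_add]
  congr 3
  abel

theorem hasSum_mFourierCoeff_mul (f g : Lp ℂ 2 (torusMeasure ν)) (ℓ : Lattice ν) :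
    HasSum (fun k => mFourierCoeff f (ℓ - k) * mFourierCoeff g k)
      (mFourierCoeff (fun θ => f θ * g θ) ℓ) := by
  have hF : MemLp (fun θ => mFourier ℓ θ * conj (f θ)) 2 (torusMeasure ν) := by
    refine (Lp.memLp f).star.of_le ?_ (Eventually.of_forall fun θ => ?_)
    · exact (mFourier ℓ).continuous.aestronglyMeasurable.mul (Lp.memLp f).star.aestronglyMeasurable
    · rw [norm_mul]
      exact mul_le_of_le_one_left (norm_nonneg _)
        (((mFourier ℓ).norm_coe_le_norm θ).trans mFourier_norm.le)
  -- Parseval's identity for `g` and the conjugate of `f`, modulated by `ℓ`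
  have h := hasSum_prod_mFourierCoeff hF.toLp g
  have hcoeff : mFourierCoeff (hF.toLp _) = fun k => conj (mFourierCoeff f (ℓ - k)) :=
    funext fun k => (congrFun (mFourierCoeff_congr_ae hF.coeFn_toLp) k).trans
      (mFourierCoeff_mFourier_mul_conj f ℓ k)
  simp only [hcoeff, Complex.conj_conj] at h
  convert h using 1
  refine integral_congr_ae ?_
  filter_upwards [hF.coeFn_toLp] with θ hθ
  rw [hθ, map_mul, Complex.conj_conj, mFourier_neg, smul_eq_mul, mul_assoc]

end FourierCoefficients

section FourierSeries

variable {ν : ℕ} {a b : Lattice ν → ℂ}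

/-- The function with Fourier series `∑_ℓ a_ℓ e^{-i ℓᵀ σ}`, in the sign convention of `symbol`: its
`ℓ`-th Fourier coefficient in the sense of `mFourierCoeff` is `a_{-ℓ}`. -/
def fourierSeries (a : Lattice ν → ℂ) : Lp ℂ 2 (torusMeasure ν) :=
  ∑' ℓ, a ℓ • mFourierLp 2 (-ℓ)

theorem symbol_apply {p q : ℕ} (M : MatSeq ν p q) (θ : UnitAddTorus (Fin ν)) (i : Fin p)
    (j : Fin q) : symbol M θ i j = fourierSeries (fun ℓ => (M ℓ i j : ℂ)) θ := rfl

theorem memℓp_comp_neg (ha : Memℓp a 2) : Memℓp (fun ℓ => a (-ℓ)) 2 :=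
  memℓp_gen ((Equiv.neg (Lattice ν)).summable_iff.2 (ha.summable (by simp)))

theorem fourierSeries_eq_repr_symm (ha : Memℓp a 2) :
    fourierSeries a = mFourierBasis.repr.symm ⟨fun ℓ => a (-ℓ), memℓp_comp_neg ha⟩ := by
  have h := (Equiv.neg (Lattice ν)).hasSum_iff.2
    (mFourierBasis.hasSum_repr_symm ⟨fun ℓ => a (-ℓ), memℓp_comp_neg ha⟩)
  refine (tsum_congr fun ℓ => ?_).trans h.tsum_eq
  simp only [Function.comp_apply, Equiv.neg_apply, neg_neg, coe_mFourierBasis]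

theorem fourierSeries_add (ha : Memℓp a 2) (hb : Memℓp b 2) :
    fourierSeries (a + b) = fourierSeries a + fourierSeries b := by
  rw [fourierSeries_eq_repr_symm ha, fourierSeries_eq_repr_symm hb,
    fourierSeries_eq_repr_symm (ha.add hb), ← map_add]
  rfl

theorem mFourierCoeff_fourierSeries (ha : Memℓp a 2) (ℓ : Lattice ν) :
    mFourierCoeff (fourierSeries a) ℓ = a (-ℓ) := by
  rw [← mFourierBasis_repr, fourierSeries_eq_repr_symm ha, LinearIsometryEquiv.apply_symm_apply]

theorem memℓp_mFourierCoeff (f : Lp ℂ 2 (torusMeasure ν)) : Memℓp (mFourierCoeff f) 2 :=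
  funext (mFourierBasis_repr f) ▸ lp.memℓp (mFourierBasis.repr f)

theorem fourierSeries_mFourierCoeff_neg (f : Lp ℂ 2 (torusMeasure ν)) :
    fourierSeries (fun ℓ => mFourierCoeff f (-ℓ)) = f :=
  ((Equiv.neg (Lattice ν)).hasSum_iff.2 (hasSum_mFourier_series_L2 f)).tsum_eq

theorem hasSum_integral_conj_fourierSeries_mul (ha : Memℓp a 2) (hb : Memℓp b 2) :
    HasSum (fun ℓ => conj (a ℓ) * b ℓ)
      (∫ θ, conj (fourierSeries a θ) * fourierSeries b θ ∂(torusMeasure ν)) := by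
  have h := (Equiv.neg (Lattice ν)).hasSum_iff.2
    (hasSum_prod_mFourierCoeff (fourierSeries a) (fourierSeries b))
  refine h.congr_fun fun ℓ => ?_
  simp only [Function.comp_apply, Equiv.neg_apply, mFourierCoeff_fourierSeries ha,
    mFourierCoeff_fourierSeries hb, neg_neg]

theorem fourierSeries_conj_neg (ha : Memℓp a 2) :
    fourierSeries (fun ℓ => conj (a (-ℓ))) =ᵐ[torusMeasure ν]
      fun θ => conj (fourierSeries a θ) := by
  have hconj : Memℓp (fun ℓ => conj (a (-ℓ))) 2 := (memℓp_comp_neg ha).star_mem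
  refine ae_eq_of_mFourierCoeff_eq (integrable_coeFn_L2 _)
    (Complex.conjLIE.integrable_comp_iff.2 (integrable_coeFn_L2 _)) fun ℓ => ?_
  have h := mFourierCoeff_mFourier_mul_conj (fourierSeries a) 0 ℓ
  simp only [mFourier_zero, ContinuousMap.one_apply, one_mul, zero_sub] at h
  rw [h, mFourierCoeff_fourierSeries hconj, mFourierCoeff_fourierSeries ha, neg_neg]

theorem hasSum_mFourierCoeff_fourierSeries_mul (ha : Memℓp a 2) (hb : Memℓp b 2)
    (j : Lattice ν) :
    HasSum (fun k => a (j - k) * b k)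
      (mFourierCoeff (fun θ => fourierSeries a θ * fourierSeries b θ) (-j)) := by
  have h := (Equiv.neg (Lattice ν)).hasSum_iff.2
    (hasSum_mFourierCoeff_mul (fourierSeries a) (fourierSeries b) (-j))
  refine h.congr_fun fun k => ?_
  simp only [Function.comp_apply, Equiv.neg_apply, mFourierCoeff_fourierSeries ha,
    mFourierCoeff_fourierSeries hb, neg_neg, neg_sub]
  congr 2
  abel

end FourierSeries

section Signals

variable {ν p q : ℕ}

/-- The values at the lattice sites of the `i`-th component of the complex valued signal
`z.1 + i z.2`; such a signal is encoded as a pair of real ones. -/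
def component (z : Sig ν p × Sig ν p) (i : Fin p) (ℓ : Lattice ν) : ℂ := ⟨z.1 ℓ i, z.2 ℓ i⟩

/-- The spatial Fourier transform of the complex valued signal `z.1 + i z.2`. -/
def hat (z : Sig ν p × Sig ν p) (θ : UnitAddTorus (Fin ν)) : Fin p → ℂ :=
  fun i => fourierSeries (component z i) θ

theorem memℓp_component (z : Sig ν p × Sig ν p) (i : Fin p) : Memℓp (component z i) 2 := by
  have h (f : Sig ν p) : Summable fun ℓ => ‖f ℓ‖ ^ 2 := by
    simpa using (lp.memℓp f).summable (by simp)
  have hle (f : Sig ν p) (ℓ : Lattice ν) : f ℓ i ^ 2 ≤ ‖f ℓ‖ ^ 2 := by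
    simpa using pow_le_pow_left₀ (norm_nonneg _) (PiLp.norm_apply_le (f ℓ) i) 2
  refine memℓp_gen (((h z.1).add (h z.2)).of_nonneg_of_le (fun ℓ => by positivity) fun ℓ => ?_)
  rw [ENNReal.toReal_ofNat, Real.rpow_ofNat, ← Complex.normSq_eq_norm_sq, Complex.normSq_apply,
    ← sq, ← sq]
  exact add_le_add (hle z.1 ℓ) (hle z.2 ℓ)

theorem hat_add (z w : Sig ν p × Sig ν p) : hat (z + w) =ᵐ[torusMeasure ν] hat z + hat w := by
  have h : ∀ᵐ θ ∂(torusMeasure ν), ∀ i,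
      (fourierSeries (component z i) + fourierSeries (component w i)) θ = _ :=
    ae_all_iff.2 fun i => Lp.coeFn_add _ _
  filter_upwards [h] with θ h
  ext i
  rw [Pi.add_apply, Pi.add_apply, hat, hat, hat, ← Pi.add_apply (ι := UnitAddTorus (Fin ν)), ← h,
    ← fourierSeries_add (memℓp_component z i) (memℓp_component w i)]
  rfl

theorem exists_hat_eq (Φ : Fin p → Lp ℂ 2 (torusMeasure ν)) :
    ∃ z : Sig ν p × Sig ν p, hat z = fun θ i => Φ i θ := by
  have hsig (φ : ℂ → ℝ) (hφ : ∀ w, |φ w| ≤ ‖w‖) :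
      ∃ f : Sig ν p, ∀ ℓ i, f ℓ i = φ (mFourierCoeff (Φ i) (-ℓ)) := by
    refine ⟨⟨fun ℓ => WithLp.toLp 2 fun i => φ (mFourierCoeff (Φ i) (-ℓ)), memℓp_gen ?_⟩,
      fun ℓ i => rfl⟩
    simp only [ENNReal.toReal_ofNat, Real.rpow_ofNat, EuclideanSpace.norm_sq_eq]
    refine summable_sum fun i _ => ?_
    have h := (memℓp_comp_neg (memℓp_mFourierCoeff (Φ i))).summable (by simp)
    refine h.of_nonneg_of_le (fun ℓ => by positivity) fun ℓ => ?_
    rw [ENNReal.toReal_ofNat, Real.rpow_ofNat]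
    exact pow_le_pow_left₀ (norm_nonneg _) (hφ _) 2
  obtain ⟨f, hf⟩ := hsig Complex.re Complex.abs_re_le_norm
  obtain ⟨g, hg⟩ := hsig Complex.im Complex.abs_im_le_norm
  have hcomp (i : Fin p) : component (f, g) i = fun ℓ => mFourierCoeff (Φ i) (-ℓ) :=
    funext fun ℓ => Complex.ext (hf ℓ i) (hg ℓ i)
  refine ⟨(f, g), funext₂ fun θ i => ?_⟩
  rw [hat, hcomp, fourierSeries_mFourierCoeff_neg]

theorem integrable_conj_hat_mul_hat (z w : Sig ν p × Sig ν p) (i : Fin p) :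
    Integrable (fun θ => conj (hat z θ i) * hat w θ i) (torusMeasure ν) :=
  (Lp.memLp _).star.integrable_mul (Lp.memLp _)

theorem integrable_star_hat_dotProduct_hat (z w : Sig ν p × Sig ν p) :
    Integrable (fun θ => star (hat z θ) ⬝ᵥ hat w θ) (torusMeasure ν) :=
  integrable_finsetSum _ fun i _ => integrable_conj_hat_mul_hat z w i

theorem integral_re_star_hat_dotProduct_hat (z w : Sig ν p × Sig ν p) :
    ∫ θ, (star (hat z θ) ⬝ᵥ hat w θ).re ∂(torusMeasure ν)
      = inner ℝ z.1 w.1 + inner ℝ z.2 w.2 := by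
  have hint : ∫ θ, star (hat z θ) ⬝ᵥ hat w θ ∂(torusMeasure ν)
      = ∑ i, ∫ θ, conj (hat z θ i) * hat w θ i ∂(torusMeasure ν) :=
    integral_finsetSum _ fun i _ => integrable_conj_hat_mul_hat z w i
  have hsum := Complex.hasSum_re (hasSum_sum (s := Finset.univ) fun i _ =>
    hasSum_integral_conj_fourierSeries_mul (memℓp_component z i) (memℓp_component w i))
  refine (integral_re (integrable_star_hat_dotProduct_hat z w)).trans ?_
  rw [hint]
  refine hsum.unique (((lp.hasSum_inner (𝕜 := ℝ) z.1 w.1).add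
    (lp.hasSum_inner (𝕜 := ℝ) z.2 w.2)).congr_fun fun ℓ => ?_)
  simp [component, PiLp.inner_apply, Finset.sum_add_distrib, mul_comm]

end Signals

section Toeplitz

variable {ν p q : ℕ}

theorem IsBoundedToeplitz.memℓp_entry {M : MatSeq ν p q} (hM : IsBoundedToeplitz M) (i : Fin p)
    (j : Fin q) : Memℓp (fun ℓ => (M ℓ i j : ℂ)) 2 := by
  -- the `j`-th column of `M` is the impulse response of the operator to the `j`-th unit input
  let δ : Sig ν q := lp.single 2 0 (EuclideanSpace.single j 1)
  have hδ (ℓ : Lattice ν) : toeplitz M δ ℓ i = M ℓ i j := by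
    have h := hasSum_single (f := fun k => Matrix.toEuclideanLin (M (ℓ - k)) (δ k)) 0 fun k hk => by
      simp [δ, Pi.single_eq_of_ne hk]
    rw [(toeplitz_spec hM δ ℓ).unique h]
    simp [δ]
  have hcomp : component (toeplitz M δ, 0) i = fun ℓ => (M ℓ i j : ℂ) :=
    funext fun ℓ => Complex.ext (hδ ℓ) rfl
  exact hcomp ▸ memℓp_component (toeplitz M δ, 0) i

theorem hasSum_component_toeplitz {M : MatSeq ν p q} (hM : IsBoundedToeplitz M)
    (z : Sig ν q × Sig ν q) (i : Fin p) (ℓ : Lattice ν) :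
    HasSum (fun k => ∑ j, (M (ℓ - k) i j : ℂ) * component z j k)
      (component (Prod.map (toeplitz M) (toeplitz M) z) i ℓ) := by
  have h (f : Sig ν q) : HasSum (fun k => ∑ j, M (ℓ - k) i j * f k j) (toeplitz M f ℓ i) :=
    (toeplitz_spec hM f ℓ).mapL (EuclideanSpace.proj i)
  rw [Complex.hasSum_iff]
  exact ⟨by simpa [component] using h z.1, by simpa [component] using h z.2⟩

theorem hat_toeplitz {M : MatSeq ν p q} (hM : IsBoundedToeplitz M) (z : Sig ν q × Sig ν q) :
    hat (Prod.map (toeplitz M) (toeplitz M) z) =ᵐ[torusMeasure ν]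
      fun θ => symbol M θ *ᵥ hat z θ := by
  have hint (i : Fin p) (j : Fin q) :=
    integrable_mul_coeFn_L2 (fourierSeries fun ℓ => (M ℓ i j : ℂ)) (fourierSeries (component z j))
  have h : ∀ᵐ θ ∂(torusMeasure ν), ∀ i,
      hat (Prod.map (toeplitz M) (toeplitz M) z) θ i = ∑ j, symbol M θ i j * hat z θ j := by
    refine ae_all_iff.2 fun i => ae_eq_of_mFourierCoeff_eq (integrable_coeFn_L2 _)
      (integrable_finsetSum _ fun j _ => hint i j) fun ℓ => ?_
    have hconv := hasSum_sum (s := Finset.univ) fun j _ =>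
      hasSum_mFourierCoeff_fourierSeries_mul (hM.memℓp_entry i j) (memℓp_component z j) (-ℓ)
    refine (mFourierCoeff_fourierSeries (memℓp_component _ i) ℓ).trans <|
      ((hasSum_component_toeplitz hM z i (-ℓ)).unique hconv).trans ?_
    simp only [neg_neg, mFourierCoeff_eq_integral_torusMeasure, Finset.smul_sum]
    exact (integral_finsetSum _ fun j _ => integrable_mFourier_smul (hint i j) (-ℓ)).symm
  filter_upwards [h] with θ h using funext h

theorem symbol_isHermitian {V : MatSeq ν p p} (hV : IsBoundedToeplitz V)
    (hsymm : ∀ ℓ, V (-ℓ) = (V ℓ)ᵀ) : ∀ᵐ θ ∂(torusMeasure ν), (symbol V θ).IsHermitian := by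
  have h : ∀ᵐ θ ∂(torusMeasure ν), ∀ i j : Fin p, _ = conj (symbol V θ i j) :=
    ae_all_iff.2 fun i => ae_all_iff.2 fun j => fourierSeries_conj_neg (hV.memℓp_entry i j)
  filter_upwards [h] with θ h
  ext i j
  rw [Matrix.conjTranspose_apply, Complex.star_def, ← h, symbol_apply]
  simp only [Complex.conj_ofReal, hsymm, Matrix.transpose_apply]

theorem isSymmetric_toeplitz {V : MatSeq ν p p} (hV : IsBoundedToeplitz V)
    (hsymm : ∀ ℓ, V (-ℓ) = (V ℓ)ᵀ) : (toeplitz V).IsSymmetric := by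
  intro f g
  have hl := integral_re_star_hat_dotProduct_hat (Prod.map (toeplitz V) (toeplitz V) (f, 0)) (g, 0)
  have hr := integral_re_star_hat_dotProduct_hat (f, 0) (Prod.map (toeplitz V) (toeplitz V) (g, 0))
  simp only [Prod.map_apply, inner_zero_right, inner_zero_left, add_zero] at hl hr
  refine hl.symm.trans ((integral_congr_ae ?_).trans hr)
  filter_upwards [symbol_isHermitian hV hsymm, hat_toeplitz hV (f, 0), hat_toeplitz hV (g, 0)]
    with θ hθ hf hg
  simp only [Prod.map_apply] at hf hg
  rw [hf, hg, Matrix.star_mulVec, hθ.eq, Matrix.dotProduct_mulVec]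

end Toeplitz

section PosSemidef

variable {𝕜 ι X : Type*} [RCLike 𝕜] [Fintype ι]

theorem star_dotProduct_add_conjTranspose_mulVec (M : Matrix ι ι 𝕜) (c : ι → 𝕜) :
    star c ⬝ᵥ ((M + Mᴴ) *ᵥ c) = ((2 * RCLike.re (star c ⬝ᵥ (M *ᵥ c)) : ℝ) : 𝕜) := by
  have hadj : star c ⬝ᵥ (Mᴴ *ᵥ c) = conj (star c ⬝ᵥ (M *ᵥ c)) := by
    rw [← RCLike.star_def, ← Matrix.star_dotProduct, Matrix.star_mulVec, Matrix.dotProduct_mulVec]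
  rw [Matrix.add_mulVec, dotProduct_add, hadj, RCLike.add_conj, RCLike.ofReal_mul,
    RCLike.ofReal_ofNat]

theorem posSemidef_add_conjTranspose_iff {M : Matrix ι ι 𝕜} :
    (M + Mᴴ).PosSemidef ↔ ∀ c, 0 ≤ RCLike.re (star c ⬝ᵥ (M *ᵥ c)) := by
  simp only [Matrix.posSemidef_iff_dotProduct_mulVec, Matrix.isHermitian_add_transpose_self,
    star_dotProduct_add_conjTranspose_mulVec, RCLike.ofReal_nonneg, true_and, Nat.ofNat_pos,
    mul_nonneg_iff_of_pos_left]

theorem ae_posSemidef_of_forall_setIntegral_nonneg [MeasurableSpace X] {μ : Measure X}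
    {M : X → Matrix ι ι 𝕜}
    (hint : ∀ c, Integrable (fun x => RCLike.re (star c ⬝ᵥ (M x *ᵥ c))) μ)
    (hM : ∀ c s, MeasurableSet s → μ s < ⊤ → 0 ≤ ∫ x in s, RCLike.re (star c ⬝ᵥ (M x *ᵥ c)) ∂μ) :
    ∀ᵐ x ∂μ, (M x + (M x)ᴴ).PosSemidef := by
  have hdense : ∀ᵐ x ∂μ, ∀ k,
      0 ≤ RCLike.re (star (TopologicalSpace.denseSeq (ι → 𝕜) k) ⬝ᵥ
        (M x *ᵥ TopologicalSpace.denseSeq (ι → 𝕜) k)) :=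
    ae_all_iff.2 fun k => ae_nonneg_of_forall_setIntegral_nonneg (hint _) (hM _)
  filter_upwards [hdense] with x hx
  refine posSemidef_add_conjTranspose_iff.2 fun c => ?_
  refine (TopologicalSpace.denseRange_denseSeq (ι → 𝕜)).induction_on c ?_ hx
  refine isClosed_le continuous_const (RCLike.continuous_re.comp ?_)
  exact continuous_star.dotProduct (continuous_const.matrix_mulVec continuous_id)

end PosSemidef

section DissipationForm

variable {ν n m r : ℕ}

namespace Network

/-- The quadratic form `⟪u, G (C x + D u)⟫ - ⟪x, V (A x + B u)⟫`, whose value at the current state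
and input is the energy dissipation rate. -/
def dissipationForm (P : Network ν n m r) (x : Sig ν n) (u : Sig ν m) : ℝ :=
  inner ℝ u (toeplitz P.G (toeplitz P.C x + toeplitz P.D u))
    - inner ℝ x (toeplitz P.V (toeplitz P.A x + toeplitz P.B u))

/-- The symbol of the block operator
`(x, u) ↦ (-V (A x + B u), G (C x + D u))`, whose quadratic form is the dissipation form. -/
def dissipationSymbol (P : Network ν n m r) (θ : UnitAddTorus (Fin ν)) :
    Matrix (Fin n ⊕ Fin m) (Fin n ⊕ Fin m) ℂ :=
  Matrix.fromBlocks (-(symbol P.V θ * symbol P.A θ)) (-(symbol P.V θ * symbol P.B θ))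
    (symbol P.G θ * symbol P.C θ) (symbol P.G θ * symbol P.D θ)

theorem dissipationSymbol_mulVec (P : Network ν n m r) (θ : UnitAddTorus (Fin ν))
    (x : Fin n → ℂ) (u : Fin m → ℂ) :
    P.dissipationSymbol θ *ᵥ Sum.elim x u =
      Sum.elim (-(symbol P.V θ *ᵥ (symbol P.A θ *ᵥ x + symbol P.B θ *ᵥ u)))
        (symbol P.G θ *ᵥ (symbol P.C θ *ᵥ x + symbol P.D θ *ᵥ u)) := by
  simp only [dissipationSymbol, Matrix.fromBlocks_mulVec, Sum.elim_comp_inl, Sum.elim_comp_inr,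
    Matrix.neg_mulVec, Matrix.mulVec_add, Matrix.mulVec_mulVec, neg_add]

theorem N_eq_dissipationSymbol_add_conjTranspose (P : Network ν n m r)
    {θ : UnitAddTorus (Fin ν)} (hV : (symbol P.V θ).IsHermitian) :
    P.N θ = P.dissipationSymbol θ + (P.dissipationSymbol θ)ᴴ := by
  simp only [N, dissipationSymbol, Matrix.fromBlocks_conjTranspose, Matrix.fromBlocks_add,
    Matrix.conjTranspose_neg, Matrix.conjTranspose_mul, hV.eq]
  congr 1 <;> abel

/-- The standing assumptions on a network: its matrices specify bounded block Toeplitz operators,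
and that of the energy is symmetric. -/
structure Regular (P : Network ν n m r) : Prop where
  isBoundedToeplitz_A : IsBoundedToeplitz P.A
  isBoundedToeplitz_B : IsBoundedToeplitz P.B
  isBoundedToeplitz_C : IsBoundedToeplitz P.C
  isBoundedToeplitz_D : IsBoundedToeplitz P.D
  isBoundedToeplitz_G : IsBoundedToeplitz P.G
  isBoundedToeplitz_V : IsBoundedToeplitz P.V
  V_neg : ∀ ℓ, P.V (-ℓ) = (P.V ℓ)ᵀ

end Network

theorem hat_toeplitz_add {p q s : ℕ} {K : MatSeq ν p q} {L : MatSeq ν p s}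
    (hK : IsBoundedToeplitz K) (hL : IsBoundedToeplitz L) (x : Sig ν q × Sig ν q)
    (u : Sig ν s × Sig ν s) :
    hat (toeplitz K x.1 + toeplitz L u.1, toeplitz K x.2 + toeplitz L u.2) =ᵐ[torusMeasure ν]
      fun θ => symbol K θ *ᵥ hat x θ + symbol L θ *ᵥ hat u θ :=
  (hat_add (Prod.map (toeplitz K) (toeplitz K) x) (Prod.map (toeplitz L) (toeplitz L) u)).trans
    ((hat_toeplitz hK x).add (hat_toeplitz hL u))

/-- The spatial Fourier transform of a pair of complex valued signals, a state and an input. -/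
def hatPair (x : Sig ν n × Sig ν n) (u : Sig ν m × Sig ν m) (θ : UnitAddTorus (Fin ν)) :
    Fin n ⊕ Fin m → ℂ :=
  Sum.elim (hat x θ) (hat u θ)

theorem exists_hatPair_ae_eq_indicator {s : Set (UnitAddTorus (Fin ν))} (hs : MeasurableSet s)
    (c : Fin n ⊕ Fin m → ℂ) :
    ∃ (x : Sig ν n × Sig ν n) (u : Sig ν m × Sig ν m),
      hatPair x u =ᵐ[torusMeasure ν] s.indicator fun _ => c := by
  let Φ (k : Fin n ⊕ Fin m) : Lp ℂ 2 (torusMeasure ν) :=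
    indicatorConstLp 2 hs (measure_ne_top _ _) (c k)
  obtain ⟨x, hx⟩ := exists_hat_eq (Φ ∘ Sum.inl)
  obtain ⟨u, hu⟩ := exists_hat_eq (Φ ∘ Sum.inr)
  have hΦ : ∀ᵐ θ ∂(torusMeasure ν), ∀ k, Φ k θ = s.indicator (fun _ => c k) θ :=
    ae_all_iff.2 fun k => indicatorConstLp_coeFn
  refine ⟨x, u, ?_⟩
  filter_upwards [hΦ] with θ hθ
  have hpair : hatPair x u θ = fun k => Φ k θ := by
    rw [hatPair, hx, hu]
    exact Sum.elim_comp_inl_inr fun k => Φ k θ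
  ext k
  by_cases hmem : θ ∈ s <;> simp [hpair, hθ, hmem]

namespace Network

variable {P : Network ν n m r}

theorem Regular.dissipationSymbol_mulVec_hatPair (hP : P.Regular) (x : Sig ν n × Sig ν n)
    (u : Sig ν m × Sig ν m) :
    ∀ᵐ θ ∂(torusMeasure ν), P.dissipationSymbol θ *ᵥ hatPair x u θ =
      Sum.elim
        (-hat (toeplitz P.V (toeplitz P.A x.1 + toeplitz P.B u.1),
          toeplitz P.V (toeplitz P.A x.2 + toeplitz P.B u.2)) θ)
        (hat (toeplitz P.G (toeplitz P.C x.1 + toeplitz P.D u.1),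
          toeplitz P.G (toeplitz P.C x.2 + toeplitz P.D u.2)) θ) := by
  filter_upwards [hat_toeplitz_add hP.isBoundedToeplitz_A hP.isBoundedToeplitz_B x u,
    hat_toeplitz_add hP.isBoundedToeplitz_C hP.isBoundedToeplitz_D x u,
    hat_toeplitz hP.isBoundedToeplitz_V
      (toeplitz P.A x.1 + toeplitz P.B u.1, toeplitz P.A x.2 + toeplitz P.B u.2),
    hat_toeplitz hP.isBoundedToeplitz_G
      (toeplitz P.C x.1 + toeplitz P.D u.1, toeplitz P.C x.2 + toeplitz P.D u.2)]
    with θ hAB hCD hV hG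
  rw [hatPair, dissipationSymbol_mulVec, ← hAB, ← hCD, ← hV, ← hG]
  rfl

theorem Regular.re_star_hatPair_dotProduct_ae_eq (hP : P.Regular) (x : Sig ν n × Sig ν n)
    (u : Sig ν m × Sig ν m) :
    (fun θ => (star (hatPair x u θ) ⬝ᵥ (P.dissipationSymbol θ *ᵥ hatPair x u θ)).re)
      =ᵐ[torusMeasure ν] fun θ =>
        (star (hat u θ) ⬝ᵥ hat (toeplitz P.G (toeplitz P.C x.1 + toeplitz P.D u.1),
          toeplitz P.G (toeplitz P.C x.2 + toeplitz P.D u.2)) θ).re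
        - (star (hat x θ) ⬝ᵥ hat (toeplitz P.V (toeplitz P.A x.1 + toeplitz P.B u.1),
          toeplitz P.V (toeplitz P.A x.2 + toeplitz P.B u.2)) θ).re := by
  filter_upwards [hP.dissipationSymbol_mulVec_hatPair x u] with θ hθ
  rw [hθ, hatPair, Function.star_sumElim, sumElim_dotProduct_sumElim, dotProduct_neg,
    Complex.add_re, Complex.neg_re, neg_add_eq_sub]

theorem Regular.integrable_re_star_hatPair_dotProduct (hP : P.Regular) (x : Sig ν n × Sig ν n)
    (u : Sig ν m × Sig ν m) :
    Integrable (fun θ => (star (hatPair x u θ) ⬝ᵥ (P.dissipationSymbol θ *ᵥ hatPair x u θ)).re)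
      (torusMeasure ν) :=
  ((integrable_star_hat_dotProduct_hat _ _).re.sub
    (integrable_star_hat_dotProduct_hat _ _).re).congr
    (hP.re_star_hatPair_dotProduct_ae_eq x u).symm

theorem Regular.integral_re_star_hatPair_dotProduct (hP : P.Regular) (x : Sig ν n × Sig ν n)
    (u : Sig ν m × Sig ν m) :
    ∫ θ, (star (hatPair x u θ) ⬝ᵥ (P.dissipationSymbol θ *ᵥ hatPair x u θ)).re ∂(torusMeasure ν)
      = P.dissipationForm x.1 u.1 + P.dissipationForm x.2 u.2 := by
  refine (integral_congr_ae (hP.re_star_hatPair_dotProduct_ae_eq x u)).trans <|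
    (integral_sub (integrable_star_hat_dotProduct_hat _ _).re
      (integrable_star_hat_dotProduct_hat _ _).re).trans ?_
  simp only [RCLike.re_eq_complex_re, integral_re_star_hat_dotProduct_hat, dissipationForm]
  ring

theorem Regular.ae_posSemidef_of_dissipationForm_nonneg (hP : P.Regular)
    (hform : ∀ x u, 0 ≤ P.dissipationForm x u) :
    ∀ᵐ θ ∂(torusMeasure ν), (P.dissipationSymbol θ + (P.dissipationSymbol θ)ᴴ).PosSemidef := by
  refine ae_posSemidef_of_forall_setIntegral_nonneg (fun c => ?_) fun c s hs _ => ?_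
  · obtain ⟨x, u, h⟩ := exists_hatPair_ae_eq_indicator MeasurableSet.univ c
    refine (hP.integrable_re_star_hatPair_dotProduct x u).congr ?_
    filter_upwards [h] with θ hθ
    simp [hθ]
  · obtain ⟨x, u, h⟩ := exists_hatPair_ae_eq_indicator hs c
    have hint := hP.integral_re_star_hatPair_dotProduct x u
    have hset : ∫ θ in s, (star c ⬝ᵥ (P.dissipationSymbol θ *ᵥ c)).re ∂(torusMeasure ν) =
        ∫ θ, (star (hatPair x u θ) ⬝ᵥ (P.dissipationSymbol θ *ᵥ hatPair x u θ)).re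
          ∂(torusMeasure ν) := by
      rw [← integral_indicator hs]
      refine integral_congr_ae ?_
      filter_upwards [h] with θ hθ
      by_cases hmem : θ ∈ s <;> simp [hθ, hmem]
    exact (hset.trans hint).ge.trans' (add_nonneg (hform _ _) (hform _ _))

theorem Regular.ae_posSemidef_N_iff (hP : P.Regular) :
    (∀ᵐ θ ∂(torusMeasure ν), (P.N θ).PosSemidef) ↔ ∀ x u, 0 ≤ P.dissipationForm x u := by
  have hN : ∀ᵐ θ ∂(torusMeasure ν), P.N θ = P.dissipationSymbol θ + (P.dissipationSymbol θ)ᴴ :=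
    (symbol_isHermitian hP.isBoundedToeplitz_V hP.V_neg).mono
      fun _ => P.N_eq_dissipationSymbol_add_conjTranspose
  refine ⟨fun h x u => ?_, fun h => ?_⟩
  · have hint := hP.integral_re_star_hatPair_dotProduct (x, x) (u, u)
    have hnonneg : 0 ≤ ∫ θ, (star (hatPair (x, x) (u, u) θ) ⬝ᵥ
        (P.dissipationSymbol θ *ᵥ hatPair (x, x) (u, u) θ)).re ∂(torusMeasure ν) := by
      refine integral_nonneg_of_ae ?_
      filter_upwards [h, hN] with θ hθ hNθ
      exact posSemidef_add_conjTranspose_iff.1 (hNθ ▸ hθ) _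
    linarith
  · filter_upwards [hP.ae_posSemidef_of_dissipationForm_nonneg h, hN] with θ hθ hNθ
    exact hNθ ▸ hθ

end Network

end DissipationForm

section Calculus

theorem ae_hasDerivAt_of_eq_add_integral {E : Type*} [NormedAddCommGroup E] [NormedSpace ℝ E]
    [CompleteSpace E] {f g : ℝ → E} {c : E} (hg : ∀ T, 0 < T → IntegrableOn g (Set.Ioc 0 T))
    (hf : ∀ t, 0 ≤ t → f t = c + ∫ τ in (0 : ℝ)..t, g τ) :
    ∀ᵐ t ∂(volume.restrict (Set.Ioi (0 : ℝ))), HasDerivAt f (g t) t := by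
  have hint (k : ℕ) : IntervalIntegrable g volume 0 (k + 1) :=
    (intervalIntegrable_iff_integrableOn_Ioc_of_le (by positivity)).2 (hg _ (by positivity))
  rw [ae_restrict_iff' measurableSet_Ioi]
  filter_upwards [ae_all_iff.2 fun k => (hint k).ae_hasDerivAt_integral] with t ht ht0
  obtain ⟨k, hk⟩ := exists_nat_gt t
  have hmem : t ∈ Set.uIcc (0 : ℝ) (k + 1) :=
    Set.Icc_subset_uIcc ⟨(Set.mem_Ioi.1 ht0).le, by linarith⟩
  refine ((ht k hmem 0 Set.left_mem_uIcc).const_add c).congr_of_eventuallyEq ?_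
  filter_upwards [Ioi_mem_nhds ht0] with s hs using hf s (Set.mem_Ioi.1 hs).le

theorem hasDerivAt_half_inner_apply_self {E : Type*} [NormedAddCommGroup E]
    [InnerProductSpace ℝ E] {T : E →L[ℝ] E} (hT : T.IsSymmetric) {x : ℝ → E} {x' : E} {t : ℝ}
    (hx : HasDerivAt x x' t) :
    HasDerivAt (fun s => (1 / 2) * inner ℝ (x s) (T (x s))) (inner ℝ (x t) (T x')) t := by
  refine ((hx.inner ℝ (T.hasFDerivAt.comp_hasDerivAt t hx)).const_mul (1 / 2 : ℝ)).congr_deriv ?_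
  have hswap : inner ℝ x' (T (x t)) = inner ℝ (x t) (T x') :=
    (hT x' (x t)).symm.trans (real_inner_comm _ _)
  rw [Function.comp_apply, hswap]
  ring

theorem exists_hasDerivAt_eq_apply_add {E : Type*} [NormedAddCommGroup E] [NormedSpace ℝ E]
    [CompleteSpace E] (A : E →L[ℝ] E) {b : ℝ → E} (hb : Continuous b) (x₀ : E) :
    ∃ x : ℝ → E, x 0 = x₀ ∧ ∀ t, HasDerivAt x (A (x t) + b t) t := by
  have hexp (B : E →L[ℝ] E) (t : ℝ) := hasDerivAt_exp_smul_const' B t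
  have hcont : Continuous fun s : ℝ => NormedSpace.exp (s • -A) (b s) :=
    (continuous_iff_continuousAt.2 fun s => (hexp (-A) s).continuousAt).clm_apply hb
  -- variation of constants
  refine ⟨fun t => NormedSpace.exp (t • A) (x₀ + ∫ s in (0 : ℝ)..t, NormedSpace.exp (s • -A) (b s)),
    by simp, fun t => ?_⟩
  refine ((hexp A t).clm_apply ((hcont.integral_hasStrictDerivAt 0 t).hasDerivAt.const_add
    x₀)).congr_deriv ?_
  let _ : NormedAlgebra ℚ (E →L[ℝ] E) := .restrictScalars ℚ ℝ _
  have hinv : NormedSpace.exp (t • A) * NormedSpace.exp (t • -A) = 1 := by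
    rw [smul_neg, ← NormedSpace.exp_add_of_commute (Commute.refl (t • A)).neg_right,
      add_neg_cancel, NormedSpace.exp_zero]
  have hinv_apply : NormedSpace.exp (t • A) (NormedSpace.exp (t • -A) (b t)) = b t :=
    DFunLike.congr_fun hinv (b t)
  rw [hinv_apply]
  rfl

theorem nonneg_of_ae_nonneg_of_continuousOn {X : Type*} [TopologicalSpace X] [MeasurableSpace X]
    {μ : Measure X} [μ.IsOpenPosMeasure] {f : X → ℝ} {U : Set X}
    (h : ∀ᵐ x ∂(μ.restrict U), 0 ≤ f x) (hf : ContinuousOn f U) (hU : U ⊆ closure (interior U)) :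
    ∀ x ∈ U, 0 ≤ f x := by
  have hmax : f =ᵐ[μ.restrict U] fun x => max (f x) 0 := by
    filter_upwards [h] with x hx using (max_eq_left hx).symm
  intro x hx
  rw [Measure.eqOn_of_ae_eq hmax hf (hf.sup continuousOn_const) hU hx]
  exact le_max_right _ _

end Calculus

section Trajectories

variable {ν n m r : ℕ}

namespace Network

variable {P : Network ν n m r} {x₀ : Sig ν n} {u : ℝ → Sig ν m} {x : ℝ → Sig ν n}

theorem IsState.ae_hasDerivAt (hx : P.IsState x₀ u x) (hu : Admissible u) :
    ∀ᵐ t ∂(volume.restrict (Set.Ioi (0 : ℝ))),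
      HasDerivAt x (toeplitz P.A (x t) + toeplitz P.B (u t)) t := by
  refine ae_hasDerivAt_of_eq_add_integral (fun T hT => .add ?_ ?_) hx.eq_integral
  · have hcont : ContinuousOn (fun τ => toeplitz P.A (x τ)) (Set.Icc 0 T) :=
      (toeplitz P.A).continuous.comp_continuousOn (hx.continuousOn.mono Set.Icc_subset_Ici_self)
    exact hcont.integrableOn_Icc.mono_set Set.Ioc_subset_Icc_self
  · exact (toeplitz P.B).integrable_comp (hu T hT)

theorem Regular.ae_hasDerivAt_energy (hP : P.Regular) (hx : P.IsState x₀ u x)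
    (hu : Admissible u) :
    ∀ᵐ t ∂(volume.restrict (Set.Ioi (0 : ℝ))), HasDerivAt (P.energy x)
      (inner ℝ (x t) (toeplitz P.V (toeplitz P.A (x t) + toeplitz P.B (u t)))) t :=
  (hx.ae_hasDerivAt hu).mono fun _ =>
    hasDerivAt_half_inner_apply_self (isSymmetric_toeplitz hP.isBoundedToeplitz_V hP.V_neg)

theorem Regular.ae_dissipationRate_eq (hP : P.Regular) (hx : P.IsState x₀ u x)
    (hu : Admissible u) :
    ∀ᵐ t ∂(volume.restrict (Set.Ioi (0 : ℝ))),
      P.dissipationRate u x t = P.dissipationForm (x t) (u t) :=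
  (hP.ae_hasDerivAt_energy hx hu).mono fun t ht => congrArg (P.supply u x t - ·) ht.deriv

theorem exists_isState_const (P : Network ν n m r) (x₀ : Sig ν n) (u₀ : Sig ν m) :
    ∃ x : ℝ → Sig ν n, Continuous x ∧ x 0 = x₀ ∧ P.IsState x₀ (fun _ => u₀) x := by
  obtain ⟨x, h0, hx⟩ := exists_hasDerivAt_eq_apply_add (toeplitz P.A)
    (b := fun _ => toeplitz P.B u₀) continuous_const x₀
  have hcont : Continuous x := continuous_iff_continuousAt.2 fun t => (hx t).continuousAt
  refine ⟨x, hcont, h0, hcont.continuousOn, fun t _ => ?_⟩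
  rw [intervalIntegral.integral_eq_sub_of_hasDerivAt (fun s _ => hx s)
    (Continuous.intervalIntegrable (by fun_prop) _ _), h0, add_sub_cancel]

theorem Regular.dissipationForm_nonneg (hP : P.Regular) (h : P.Dissipative) (x₀ : Sig ν n)
    (u₀ : Sig ν m) : 0 ≤ P.dissipationForm x₀ u₀ := by
  obtain ⟨x, hcont, h0, hx⟩ := P.exists_isState_const x₀ u₀
  have hu : Admissible fun _ : ℝ => u₀ := fun T _ => continuous_const.integrableOn_Ioc
  have hae : ∀ᵐ t ∂(volume.restrict (Set.Ici (0 : ℝ))), 0 ≤ P.dissipationForm (x t) u₀ := by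
    rw [← Measure.restrict_congr_set Ioi_ae_eq_Ici]
    filter_upwards [hP.ae_dissipationRate_eq hx hu, h _ _ x hu hx] with t hrate ht
    exact hrate ▸ ht
  have hform : Continuous fun t => P.dissipationForm (x t) u₀ := by
    unfold dissipationForm
    fun_prop
  have hnonneg := nonneg_of_ae_nonneg_of_continuousOn hae hform.continuousOn
    (by rw [interior_Ici, closure_Ioi]) 0 Set.self_mem_Ici
  rwa [h0] at hnonneg

theorem Regular.dissipative_iff (hP : P.Regular) :
    P.Dissipative ↔ ∀ x u, 0 ≤ P.dissipationForm x u := by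
  refine ⟨hP.dissipationForm_nonneg, fun h x₀ u x hu hx => ?_⟩
  filter_upwards [hP.ae_dissipationRate_eq hx hu] with t ht
  exact ht ▸ h (x t) (u t)

end Network

end Trajectories

end LatticeNet

end

theorem theorem1_general {ν n m r : ℕ} {P : LatticeNet.Network ν n m r} (hP : P.Regular) :
    (∀ (x₀ : LatticeNet.Sig ν n) (u : ℝ → LatticeNet.Sig ν m) (x : ℝ → LatticeNet.Sig ν n),
      LatticeNet.Admissible u → P.IsState x₀ u x →
        ∀ᵐ t ∂(volume.restrict (Set.Ioi (0 : ℝ))), DifferentiableAt ℝ (P.energy x) t) ∧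
    (P.Dissipative ↔ ∀ᵐ θ ∂(LatticeNet.torusMeasure ν), (P.N θ).PosSemidef) :=
  ⟨fun _ _ _ hu hx => (hP.ae_hasDerivAt_energy hx hu).mono fun _ ht => ht.differentiableAt,
    hP.dissipative_iff.trans hP.ae_posSemidef_N_iff.symm⟩

theorem theorem1 {ν n m r : ℕ} (P : LatticeNet.Network ν n m r)
    (hA : LatticeNet.SquareSummable P.A) (hB : LatticeNet.SquareSummable P.B)
    (hC : LatticeNet.SquareSummable P.C) (hD : LatticeNet.SquareSummable P.D)
    (hG : LatticeNet.SquareSummable P.G) (hV : LatticeNet.SquareSummable P.V)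
    (hA' : LatticeNet.IsBoundedToeplitz P.A) (hB' : LatticeNet.IsBoundedToeplitz P.B)
    (hC' : LatticeNet.IsBoundedToeplitz P.C) (hD' : LatticeNet.IsBoundedToeplitz P.D)
    (hG' : LatticeNet.IsBoundedToeplitz P.G) (hV' : LatticeNet.IsBoundedToeplitz P.V)
    (hVsymm : ∀ ℓ : LatticeNet.Lattice ν, P.V (-ℓ) = (P.V ℓ)ᵀ) :
    -- the energy is differentiable at almost every time, so that the dissipation rate makes sense
    (∀ (x₀ : LatticeNet.Sig ν n) (u : ℝ → LatticeNet.Sig ν m) (x : ℝ → LatticeNet.Sig ν n),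
      LatticeNet.Admissible u → P.IsState x₀ u x →
        ∀ᵐ t ∂(MeasureTheory.volume.restrict (Set.Ioi (0 : ℝ))), DifferentiableAt ℝ (P.energy x) t) ∧
    -- sufficiency, without controllability
    ((∀ᵐ θ ∂(LatticeNet.torusMeasure ν), (P.N θ).PosSemidef) → P.Dissipative) ∧
    -- the criterion under controllability
    ((∀ᵐ θ ∂(LatticeNet.torusMeasure ν),
        LatticeNet.Controllable (LatticeNet.symbol P.A θ) (LatticeNet.symbol P.B θ)) →
      (P.Dissipative ↔ ∀ᵐ θ ∂(LatticeNet.torusMeasure ν), (P.N θ).PosSemidef)) := by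
  obtain ⟨hdiff, hiff⟩ := theorem1_general ⟨hA', hB', hC', hD', hG', hV', hVsymm⟩
  exact ⟨hdiff, hiff.2, fun _ => hiff⟩
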